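/- Let $\mathbf{k}$ be an arbitrary field, let $S=\mathbf{k}[x,y,z]$, and let $I\subseteq S$ be a monomial ideal such that $S/I$ is finite-dimensional over $\mathbf{k}$, with $d=\dim_{\mathbf{k}}(S/I)$. Let $T(I)=\mathrm{Hom}_S(I,S/I)$. For $\alpha\in\mathbf{Z}^3$ let $|T(I)|_\alpha\subseteq T(I)$ be the graded component of degree $\alpha$, that is, the space of $S$-linear maps $I\to S/I$ that send homogeneous elements of $I$ of degree $\beta$ to elements of $S/I$ of degree $\alpha+\beta$, for every $\beta\in\mathbf{Z}^3$. For a triple $\mathfrak{s}=\mathfrak{s}_1\mathfrak{s}_2\mathfrak{s}_3$ of letters $\mathrm{p}$ ("positive or $0$") and $\mathrm{n}$ ("negative"), let $\mathbf{Z}^3_{\mathfrak{s}}$ be the set of $\alpha\in\mathbf{Z}^3$ with $\alpha_i\ge 0$ whenever $\mathfrak{s}_i=\mathrm{p}$ and $\alpha_i<0$ whenever $\mathfrak{s}_i=\mathrm{n}$, and put $$T_{\mathfrak{s}}(I)=\bigoplus_{\alpha\in\mathbf{Z}^3_{\mathfrak{s}}}|T(I)|_\alpha\subseteq T(I).$$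 Then $T(I)$ is finite-dimensional over $\mathbf{k}$, and $$\dim_{\mathbf{k}} T_{\mathrm{ppn}}(I)=\dim_{\mathbf{k}} T_{\mathrm{nnp}}(I)+d,\quad \dim_{\mathbf{k}} T_{\mathrm{pnp}}(I)=\dim_{\mathbf{k}} T_{\mathrm{npn}}(I)+d,\quad \dim_{\mathbf{k}} T_{\mathrm{npp}}(I)=\dim_{\mathbf{k}} T_{\mathrm{pnn}}(I)+d.$$ As a consequence, $\dim_{\mathbf{k}} T(I)\equiv d \pmod 2$. -/

import Mathlib

open MvPolynomial

/-- The two letters of a signature: `p` is "positive or zero", `n` is "negative". -/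
inductive SignLetter : Type
  | p : SignLetter
  | n : SignLetter

/-- The condition that a letter puts on a coordinate: `0 ≤ a` for `p` and `a < 0` for `n`. -/
def SignLetter.Admits : SignLetter → ℤ → Prop
  | SignLetter.p, a => 0 ≤ a
  | SignLetter.n, a => a < 0

/-- The set of all degrees in `ℤⁿ` whose coordinates have the signs prescribed by `s`. -/
def signatureDegrees {n : ℕ} (s : Fin n → SignLetter) : Set (Fin n → ℤ) :=
  {α | ∀ i, (s i).Admits (α i)}

/-- An ideal of a polynomial ring is a monomial ideal if it is generated by monomials. -/
def IsMonomialIdeal {k : Type*} [Field k] {n : ℕ} (I : Ideal (MvPolynomial (Fin n) k)) : Prop :=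
  ∃ A : Set (Fin n →₀ ℕ), I = Ideal.span ((fun u => monomial u (1 : k)) '' A)

/-- The graded component of degree `γ ∈ ℤⁿ` of `S = k[x₁, …, xₙ]`: it is spanned by the monomial
with exponent vector `γ` if `γ` has nonnegative coordinates, and is zero otherwise. -/
noncomputable def polyPiece (k : Type*) [Field k] {n : ℕ} (γ : Fin n → ℤ) :
    Submodule k (MvPolynomial (Fin n) k) :=
  Submodule.span k {f | ∃ u : Fin n →₀ ℕ, (∀ i, (u i : ℤ) = γ i) ∧ f = monomial u (1 : k)}

/-- The graded component of degree `γ ∈ ℤⁿ` of `S ⧸ I`: the image of that of `S`. -/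
noncomputable def quotientPiece {k : Type*} [Field k] {n : ℕ} (I : Ideal (MvPolynomial (Fin n) k))
    (γ : Fin n → ℤ) : Submodule k (MvPolynomial (Fin n) k ⧸ I) :=
  (polyPiece k γ).map (Ideal.Quotient.mkₐ k I).toLinearMap

/-- The space `T(I) = Hom_S(I, S ⧸ I)`, where `S = k[x₁, …, xₙ]`. -/
abbrev TangentSpaceAt {k : Type*} [Field k] {n : ℕ} (I : Ideal (MvPolynomial (Fin n) k)) : Type _ :=
  I →ₗ[MvPolynomial (Fin n) k] (MvPolynomial (Fin n) k ⧸ I)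

/-- The graded component of degree `α ∈ ℤⁿ` of `T(I)`: the `S`-linear maps `I → S ⧸ I` that send
every element of `I` that is homogeneous of degree `β` into degree `α + β`, for all `β`. -/
def tangentPiece {k : Type*} [Field k] {n : ℕ} (I : Ideal (MvPolynomial (Fin n) k))
    (α : Fin n → ℤ) : Submodule k (TangentSpaceAt I) where
  carrier := {φ | ∀ (β : Fin n → ℤ) (f : I),
    (f : MvPolynomial (Fin n) k) ∈ polyPiece k β → φ f ∈ quotientPiece I (α + β)}
  add_mem' hφ hψ β f hf := Submodule.add_mem _ (hφ β f hf) (hψ β f hf)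
  zero_mem' _ _ _ := Submodule.zero_mem _
  smul_mem' c _ hφ β f hf := Submodule.smul_mem _ c (hφ β f hf)

/-- The subspace `T_s(I)` of `T(I)`: the sum of the graded components of `T(I)` in the degrees
whose signs are prescribed by `s`. (Components of different degrees of a monomial ideal are
independent, so that this sum inside `T(I)` is direct.) -/
noncomputable def tangentSignature {k : Type*} [Field k] {n : ℕ}
    (I : Ideal (MvPolynomial (Fin n) k)) (s : Fin n → SignLetter) :
    Submodule k (TangentSpaceAt I) :=
  ⨆ α ∈ signatureDegrees s, tangentPiece I α

/-!
A `k`-linear map `h : S → S ⧸ I` that is `S`-linear on `I` is a tangent vector, extended by zero,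
plus an endomorphism of `S ⧸ I`. Such an `h` is determined by `h 1` and by its commutators
`a_j = [X_j, h]`, which vanish on `I`; conversely, any `h 1` and any endomorphisms `a_j` of `S ⧸ I`
with `[X_i, a_j] = [X_j, a_i]` arise in this way. Keeping only degrees in `A ⊆ ℤ³`, one finds
`dim T_A + dim End_A = dim C_A + dim (S ⧸ I)_A`, where `C_A` is the space of these families `(a_j)`.

Now `C_A` is the kernel of a curl, and the curl is self-adjoint for the trace form. This compares
`C_A` with `C_{A'}`, where `A' = -(1, 1, 1) - A`, and expresses `dim T_A - dim T_{A'}` through the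
dimensions of `(S ⧸ I)_A`, `(S ⧸ I)_{A'}` and the graded pieces of `End_k (S ⧸ I)`, that is, through
a signed count of pairs of standard monomials. If `A` is a product `U₀ × U₁ × U₂`, a pair `(u, v)`
contributes the product of the jumps of the indicator functions of the `U_i` at `u_i - v_i`. For an
octant this product is `±1` on the diagonal and zero elsewhere, hence the term `d`; for the half
space `α₀ ≥ 0` it is always zero, while `(S ⧸ I)_A = S ⧸ I`, hence the parity.
-/

section Finrank

variable {k V W : Type*} [Field k] [AddCommGroup V] [Module k V] [AddCommGroup W] [Module k W]

theorem finrank_span_basis_image {ι : Type*} (b : Module.Basis ι k V) (s : Set ι) :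
    Module.finrank k (Submodule.span k (b '' s)) = s.ncard := by
  rw [Set.image_eq_range, ← Nat.card_coe_set_eq]
  exact Module.finrank_eq_nat_card_basis
    (Module.Basis.span (b.linearIndependent.comp ((↑) : s → ι) Subtype.val_injective))

theorem finrank_submodule_prod (p : Submodule k V) (q : Submodule k W) [FiniteDimensional k p]
    [FiniteDimensional k q] :
    Module.finrank k (p.prod q) = Module.finrank k p + Module.finrank k q := by
  rw [← Module.finrank_prod, ← LinearMap.finrank_range_of_inj (f := p.subtype.prodMap q.subtype)
    (Function.Injective.prodMap p.injective_subtype q.injective_subtype), LinearMap.range_prodMap,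
    Submodule.range_subtype, Submodule.range_subtype]

theorem finrank_add_finrank_ker_flip [FiniteDimensional k V] [FiniteDimensional k W]
    (B : V →ₗ[k] W →ₗ[k] k) :
    Module.finrank k V + Module.finrank k (LinearMap.ker B.flip) =
      Module.finrank k W + Module.finrank k (LinearMap.ker B) := by
  have rank_flip : Module.finrank k (LinearMap.range B.flip) =
      Module.finrank k (LinearMap.range B) := by
    have flip_eq : B.flip = B.dualMap ∘ₗ (Module.evalEquiv k W).toLinearMap := rfl
    rw [flip_eq, LinearMap.range_comp_of_range_eq_top _ (LinearEquiv.range _),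
      LinearMap.finrank_range_dualMap_eq_finrank_range]
  have := B.finrank_range_add_finrank_ker
  have := B.flip.finrank_range_add_finrank_ker
  omega

end Finrank

section MatrixUnits

variable {k V ι : Type*} [CommRing k] [AddCommGroup V] [Module k V] [Fintype ι] [DecidableEq ι]
  (b : Module.Basis ι k V)

theorem end_repr_apply (ψ : Module.End k V) (i j : ι) :
    b.end.repr ψ (i, j) = b.repr (ψ (b j)) i := by
  rw [Module.Basis.linearMap_repr_apply, ← LinearMap.toMatrix_apply]
  rfl

theorem mul_end_eq_smulRight (c : Module.End k V) (i j : ι) :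
    c * b.end (i, j) = (b.coord j).smulRight (c (b i)) := by
  refine b.ext fun l => ?_
  rw [Module.End.mul_apply, Module.Basis.end_apply_apply, LinearMap.smulRight_apply,
    Module.Basis.coord_apply, b.repr_self_apply, ite_smul, one_smul, zero_smul, apply_ite c,
    map_zero]
  simp only [eq_comm]

theorem trace_mul_end (c : Module.End k V) (i j : ι) :
    LinearMap.trace k V (c * b.end (i, j)) = b.coord j (c (b i)) := by
  have := Module.Finite.of_basis b
  have := Module.Free.of_basis b
  rw [mul_end_eq_smulRight, LinearMap.trace_smulRight]

end MatrixUnits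

section Commutator

variable {k S N M : Type*} [CommRing k] [CommRing S] [Algebra k S]
  [AddCommGroup N] [Module k N] [Module S N] [IsScalarTower k S N]
  [AddCommGroup M] [Module k M] [Module S M] [IsScalarTower k S M]

/-- The commutator `h ↦ s h - h s` of a `k`-linear map between `S`-modules with multiplication by
`s ∈ S`; it measures the failure of `h` to commute with `s`. -/
def homCommutator (s : S) : (N →ₗ[k] M) →ₗ[k] (N →ₗ[k] M) where
  toFun h := Algebra.lsmul k k M s ∘ₗ h - h ∘ₗ Algebra.lsmul k k N s
  map_add' _ _ := by simp only [LinearMap.comp_add, LinearMap.add_comp]; abel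
  map_smul' _ _ := by
    simp only [LinearMap.comp_smul, LinearMap.smul_comp, smul_sub, RingHom.id_apply]

@[simp]
theorem homCommutator_apply (s : S) (h : N →ₗ[k] M) (x : N) :
    homCommutator s h x = s • h x - h (s • x) := rfl

theorem homCommutator_comm (s t : S) (h : N →ₗ[k] M) :
    homCommutator s (homCommutator t h) = homCommutator t (homCommutator s h) := by
  ext x
  simp only [homCommutator_apply, smul_sub, smul_comm s t]
  abel

theorem homCommutator_comp {P : Type*} [AddCommGroup P] [Module k P] [Module S P]
    [IsScalarTower k S P] {s : S} (h : N →ₗ[k] M) {g : P →ₗ[k] N}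
    (hg : ∀ x, g (s • x) = s • g x) :
    homCommutator s (h ∘ₗ g) = homCommutator s h ∘ₗ g := by
  ext x
  simp [hg]

theorem trace_homCommutator_mul (s : S) (a b : Module.End k N) :
    LinearMap.trace k N (homCommutator s a * b) = -LinearMap.trace k N (a * homCommutator s b) := by
  have mul_left (c d : Module.End k N) : homCommutator s c * d =
      Algebra.lsmul k k N s * (c * d) - c * Algebra.lsmul k k N s * d := rfl
  have mul_right : a * homCommutator s b =
      a * Algebra.lsmul k k N s * b - a * b * Algebra.lsmul k k N s := by
    rw [mul_assoc, mul_assoc, ← mul_sub]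
    rfl
  rw [mul_left, mul_right, map_sub, map_sub, LinearMap.trace_mul_comm k _ (a * b), neg_sub]

end Commutator

section Curl

variable {k S N : Type*} [CommRing k] [CommRing S] [Algebra k S]
  [AddCommGroup N] [Module k N] [Module S N] [IsScalarTower k S N] (x : Fin 3 → S)

/-- The curl of a triple of endomorphisms with respect to the commutators with `x₀, x₁, x₂`, that
is, the differential of the Koszul complex from degree one to degree two. -/
def curl : (Fin 3 → Module.End k N) →ₗ[k] (Fin 3 → Module.End k N) :=
  LinearMap.pi fun i => homCommutator (x (i + 1)) ∘ₗ LinearMap.proj (i + 2) -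
    homCommutator (x (i + 2)) ∘ₗ LinearMap.proj (i + 1)

theorem curl_apply (a : Fin 3 → Module.End k N) (i : Fin 3) :
    curl x a i = homCommutator (x (i + 1)) (a (i + 2)) - homCommutator (x (i + 2)) (a (i + 1)) :=
  rfl

theorem curl_eq_zero_iff {a : Fin 3 → Module.End k N} :
    curl x a = 0 ↔ ∀ i j, homCommutator (x i) (a j) = homCommutator (x j) (a i) := by
  refine ⟨fun h => ?_, fun h => _root_.funext fun i => sub_eq_zero.mpr (h _ _)⟩
  have h_apply (i : Fin 3) := sub_eq_zero.mp ((curl_apply x a i).symm.trans (congrFun h i))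
  intro i j
  fin_cases i <;> fin_cases j
  exacts [rfl, h_apply 2, (h_apply 1).symm, (h_apply 2).symm, rfl, h_apply 0, h_apply 1,
    (h_apply 0).symm, rfl]

theorem sum_trace_curl_mul (a b : Fin 3 → Module.End k N) :
    ∑ i, LinearMap.trace k N (curl x a i * b i) = ∑ i, LinearMap.trace k N (curl x b i * a i) := by
  have trace_swap (i : Fin 3) : LinearMap.trace k N (curl x b i * a i) =
      LinearMap.trace k N (a i * curl x b i) := LinearMap.trace_mul_comm k _ _
  rw [Finset.sum_congr rfl fun i _ => trace_swap i]
  simp only [curl_apply, sub_mul, mul_sub, map_sub, trace_homCommutator_mul, Fin.sum_univ_three,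
    Fin.isValue, Fin.reduceAdd, zero_add]
  ring

/-- The pairing `(a, b) ↦ ∑ tr (curl a * b)` of two spaces of triples of endomorphisms. -/
noncomputable def curlForm (W W' : Fin 3 → Submodule k (Module.End k N)) :
    (∀ i, W i) →ₗ[k] (∀ i, W' i) →ₗ[k] k :=
  LinearMap.mk₂ k (fun a b => ∑ i, LinearMap.trace k N (curl x (fun j => (a j).1) i * (b i).1))
    (fun a a' b => by
      have curl_add (i : Fin 3) : curl x (fun j => ((a + a') j).1) i =
          curl x (fun j => (a j).1) i + curl x (fun j => (a' j).1) i :=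
        congrFun (map_add (curl x) (fun j => (a j).1) _) i
      simp only [curl_add, add_mul, map_add, Finset.sum_add_distrib])
    (fun c a b => by
      have curl_smul (i : Fin 3) : curl x (fun j => ((c • a) j).1) i =
          c • curl x (fun j => (a j).1) i := congrFun (map_smul (curl x) c fun j => (a j).1) i
      simp only [curl_smul, smul_mul_assoc, map_smul, Finset.smul_sum])
    (fun a b b' => by
      simp only [Pi.add_apply, Submodule.coe_add, mul_add, map_add, Finset.sum_add_distrib])
    (fun c a b => by
      simp only [Pi.smul_apply, Submodule.coe_smul, mul_smul_comm, map_smul, Finset.smul_sum])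

theorem curlForm_apply (W W' : Fin 3 → Submodule k (Module.End k N)) (a : ∀ i, W i)
    (b : ∀ i, W' i) : curlForm x W W' a b =
      ∑ i, LinearMap.trace k N (curl x (fun j => (a j).1) i * (b i).1) := rfl

theorem curlForm_flip (W W' : Fin 3 → Submodule k (Module.End k N)) :
    (curlForm x W W').flip = curlForm x W' W :=
  LinearMap.ext₂ fun a b => sum_trace_curl_mul x (fun i => (b i).1) fun i => (a i).1

end Curl

section MvPolynomialModules

theorem exponent_induction {σ : Type*} {motive : (σ →₀ ℕ) → Prop} (zero : motive 0)
    (single_add : ∀ j u, motive u → motive (Finsupp.single j 1 + u)) (u : σ →₀ ℕ) : motive u := by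
  induction u using Finsupp.induction with
  | zero => exact zero
  | single_add j b u _ _ hu =>
    clear * - hu single_add
    induction b with
    | zero => simpa using hu
    | succ b hb =>
      rw [add_comm b, Finsupp.single_add, add_assoc]
      exact single_add j _ hb

variable {k σ : Type*} [CommRing k]

theorem X_mul_monomial (j : σ) (u : σ →₀ ℕ) (a : k) :
    X j * monomial u a = monomial (Finsupp.single j 1 + u) a := by
  rw [X, monomial_mul, one_mul]

theorem map_eq_zero_of_support {M : Type*} [AddCommGroup M] [Module k M]
    {h : MvPolynomial σ k →ₗ[k] M} {f : MvPolynomial σ k}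
    (hf : ∀ u ∈ f.support, h (monomial u 1) = 0) : h f = 0 := by
  rw [← support_sum_monomial_coeff f, map_sum]
  refine Finset.sum_eq_zero fun u hu => ?_
  rw [← mul_one (coeff u f), ← smul_eq_mul, ← smul_monomial, map_smul, hf u hu, smul_zero]

variable {N M : Type*}
  [AddCommGroup N] [Module k N] [Module (MvPolynomial σ k) N] [IsScalarTower k (MvPolynomial σ k) N]
  [AddCommGroup M] [Module k M] [Module (MvPolynomial σ k) M] [IsScalarTower k (MvPolynomial σ k) M]

theorem map_smul_of_map_X_smul (h : N →ₗ[k] M)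
    (hX : ∀ (j : σ) x, h (X (R := k) j • x) = X (R := k) j • h x) (f : MvPolynomial σ k) (x : N) :
    h (f • x) = f • h x := by
  induction f using MvPolynomial.induction_on generalizing x with
  | C a => simp only [← algebraMap_eq, algebraMap_smul, map_smul]
  | add f g hf hg => simp only [add_smul, map_add, hf, hg]
  | mul_X f j hf => simp only [mul_smul, hf, hX]

open scoped IsMulCommutative in
theorem exists_algHom_X_eq {A : Type*} [Ring A] [Algebra k A] (Y : σ → A)
    (hY : ∀ i j, Commute (Y i) (Y j)) :
    ∃ Φ : MvPolynomial σ k →ₐ[k] A, ∀ j, Φ (X j) = Y j := by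
  have : IsMulCommutative (Algebra.adjoin k (Set.range Y)) :=
    Algebra.isMulCommutative_adjoin k <| by
      rintro _ ⟨i, rfl⟩ _ ⟨j, rfl⟩
      exact hY i j
  let y (j : σ) : Algebra.adjoin k (Set.range Y) := ⟨Y j, Algebra.subset_adjoin ⟨j, rfl⟩⟩
  exact ⟨(Algebra.adjoin k (Set.range Y)).val.comp (aeval y), fun j => by simp [y]⟩

theorem exists_homCommutator_X_eq (a : σ → N →ₗ[k] M)
    (closed : ∀ i j, homCommutator (X (R := k) i) (a j) = homCommutator (X (R := k) j) (a i))
    (m : M) (y : N) :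
    ∃ h : MvPolynomial σ k →ₗ[k] M, h 1 = m ∧
      ∀ j f, homCommutator (X (R := k) j) h f = a j (f • y) := by
  -- The operators `(q, r) ↦ (X_j q - a_j r, X_j r)` on `M × N` commute, so that polynomials can be
  -- evaluated at them; the map sought is `f ↦ (f(Y) (m, y)).1`.
  let Y (j : σ) : Module.End k (M × N) :=
    (Algebra.lsmul k k M (X (R := k) j) ∘ₗ LinearMap.fst k M N - a j ∘ₗ LinearMap.snd k M N).prod
      (Algebra.lsmul k k N (X (R := k) j) ∘ₗ LinearMap.snd k M N)
  have Y_apply (j z) : Y j z = (X (R := k) j • z.1 - a j z.2, X (R := k) j • z.2) := rfl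
  have hY : ∀ i j, Commute (Y i) (Y j) := by
    refine fun i j => LinearMap.ext fun z => ?_
    have hc := LinearMap.congr_fun (closed i j) z.2
    simp only [homCommutator_apply] at hc
    simp only [Module.End.mul_apply, Y_apply, Prod.mk.injEq, smul_sub,
      smul_comm (X (R := k) j) (X (R := k) i), and_true]
    rw [sub_sub, sub_sub, sub_right_inj]
    exact sub_eq_sub_iff_add_eq_add.mp hc
  obtain ⟨Φ, hΦ⟩ := exists_algHom_X_eq (k := k) Y hY
  have snd_Φ (f : MvPolynomial σ k) (z : M × N) : (Φ f z).2 = f • z.2 := by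
    induction f using MvPolynomial.induction_on generalizing z with
    | C a =>
      simp only [← algebraMap_eq, AlgHom.commutes, algebraMap_smul, Module.algebraMap_end_apply,
        Prod.smul_snd]
    | add f g hf hg => simp [add_smul, hf, hg]
    | mul_X f j hf => simp [hΦ, hf, Y_apply, mul_smul]
  refine ⟨LinearMap.fst k M N ∘ₗ (LinearMap.applyₗ (m, y)) ∘ₗ Φ.toLinearMap, by simp, fun j f => ?_⟩
  simp [hΦ, Y_apply, snd_Φ]

end MvPolynomialModules

section MonomialDegrees

open scoped Pointwise

variable {k : Type*} [Field k] {n : ℕ} (I : Ideal (MvPolynomial (Fin n) k))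

/-- The degree in `ℤⁿ` of the monomial with exponent vector `u`. -/
def exponentDegree : (Fin n →₀ ℕ) →+ (Fin n → ℤ) where
  toFun u i := u i
  map_zero' := by ext; simp
  map_add' u v := by ext; simp

theorem exponentDegree_injective : Function.Injective (exponentDegree (n := n)) :=
  fun _ _ h => Finsupp.ext fun i => Int.ofNat_inj.mp (congrFun h i)

theorem exponentDegree_single (j : Fin n) :
    exponentDegree (Finsupp.single j 1) = Pi.single j 1 := by
  ext i
  simp [exponentDegree, Finsupp.single_apply, Pi.single_apply, eq_comm]

/-- The projection `S → S ⧸ I` as a `k`-linear map. -/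
noncomputable abbrev quotientProjection : MvPolynomial (Fin n) k →ₗ[k] MvPolynomial (Fin n) k ⧸ I :=
  (Ideal.Quotient.mkₐ k I).toLinearMap

theorem range_quotientProjection : LinearMap.range (quotientProjection I) = ⊤ :=
  LinearMap.range_eq_top.mpr (Ideal.Quotient.mkₐ_surjective k I)

/-- The class in `S ⧸ I` of the monomial with exponent vector `u`. -/
noncomputable def monomialClass (u : Fin n →₀ ℕ) : MvPolynomial (Fin n) k ⧸ I :=
  quotientProjection I (monomial u 1)

theorem X_smul_monomialClass (j : Fin n) (u : Fin n →₀ ℕ) :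
    X (R := k) j • monomialClass I u = monomialClass I (Finsupp.single j 1 + u) := by
  rw [monomialClass, monomialClass, ← X_mul_monomial]
  rfl

theorem monomialClass_eq_zero_iff (u : Fin n →₀ ℕ) :
    monomialClass I u = 0 ↔ monomial u (1 : k) ∈ I :=
  Ideal.Quotient.eq_zero_iff_mem

/-- The exponent vectors of the standard monomials of `I`, those outside `I`. -/
abbrev StandardExponent : Type := {u : Fin n →₀ ℕ // monomial u (1 : k) ∉ I}

variable {I}

theorem IsMonomialIdeal.monomial_mem (hI : IsMonomialIdeal I) {f : MvPolynomial (Fin n) k}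
    (hf : f ∈ I) {u : Fin n →₀ ℕ} (hu : u ∈ f.support) : monomial u (1 : k) ∈ I := by
  obtain ⟨A, rfl⟩ := hI
  obtain ⟨v, hv, hvu⟩ := mem_ideal_span_monomial_image.mp hf u hu
  refine mem_ideal_span_monomial_image.mpr fun w hw => ⟨v, hv, ?_⟩
  rwa [Finset.mem_singleton.mp (support_monomial_subset hw)]

theorem IsMonomialIdeal.map_eq_zero {M : Type*} [AddCommGroup M] [Module k M]
    (hI : IsMonomialIdeal I) {h : MvPolynomial (Fin n) k →ₗ[k] M}
    (hh : ∀ u, monomial u (1 : k) ∈ I → h (monomial u 1) = 0) {f : MvPolynomial (Fin n) k}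
    (hf : f ∈ I) : h f = 0 :=
  map_eq_zero_of_support fun u hu => hh u (hI.monomial_mem hf hu)

theorem IsMonomialIdeal.linearIndependent_monomialClass (hI : IsMonomialIdeal I) :
    LinearIndependent k fun u : StandardExponent I => monomialClass I u := by
  have independent := (basisMonomials (Fin n) k).linearIndependent.comp
    ((↑) : StandardExponent I → Fin n →₀ ℕ) Subtype.val_injective
  refine independent.map (f := quotientProjection I) ?_
  rw [Submodule.disjoint_def]
  intro f hf hfI
  rw [Set.range_comp, Module.Basis.mem_span_image] at hf
  refine support_eq_empty.mp (Finset.eq_empty_of_forall_notMem fun u hu => ?_)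
  obtain ⟨v, rfl⟩ := hf hu
  exact v.2 (hI.monomial_mem (Ideal.Quotient.eq_zero_iff_mem.mp hfI) hu)

theorem span_monomialClass :
    Submodule.span k (Set.range fun u : StandardExponent I => monomialClass I u) = ⊤ := by
  rw [eq_top_iff, ← range_quotientProjection, LinearMap.range_eq_map,
    ← (basisMonomials (Fin n) k).span_eq, Submodule.map_span, Submodule.span_le]
  rintro _ ⟨_, ⟨u, rfl⟩, rfl⟩
  change monomialClass I u ∈ _
  by_cases hu : monomial u (1 : k) ∈ I
  · rw [(monomialClass_eq_zero_iff I u).mpr hu]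
    exact Submodule.zero_mem _
  · exact Submodule.subset_span ⟨⟨u, hu⟩, rfl⟩

/-- The basis of `S ⧸ I` formed by the classes of the standard monomials. -/
noncomputable def standardBasis (hI : IsMonomialIdeal I) :
    Module.Basis (StandardExponent I) k (MvPolynomial (Fin n) k ⧸ I) :=
  Module.Basis.mk hI.linearIndependent_monomialClass span_monomialClass.ge

theorem standardBasis_apply (hI : IsMonomialIdeal I) (w : StandardExponent I) :
    standardBasis hI w = monomialClass I w :=
  Module.Basis.mk_apply _ _ w

variable (I)

/-- The sum of the graded components of `S ⧸ I` in the degrees that belong to `A`. -/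
noncomputable def quotientPart (A : Set (Fin n → ℤ)) : Submodule k (MvPolynomial (Fin n) k ⧸ I) :=
  Submodule.span k (monomialClass I '' (exponentDegree ⁻¹' A))

variable {I} {A B : Set (Fin n → ℤ)}

theorem monomialClass_mem_quotientPart {u : Fin n →₀ ℕ} (hu : exponentDegree u ∈ A) :
    monomialClass I u ∈ quotientPart I A :=
  Submodule.subset_span ⟨u, hu, rfl⟩

theorem quotientPiece_eq_quotientPart (γ : Fin n → ℤ) :
    quotientPiece I γ = quotientPart I {γ} := by
  rw [quotientPiece, polyPiece, Submodule.map_span, quotientPart]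
  congr 1
  ext q
  constructor
  · rintro ⟨_, ⟨u, hu, rfl⟩, rfl⟩
    exact ⟨u, funext hu, rfl⟩
  · rintro ⟨u, hu, rfl⟩
    exact ⟨_, ⟨u, congrFun hu, rfl⟩, rfl⟩

theorem quotientPart_mono (h : A ⊆ B) : quotientPart I A ≤ quotientPart I B :=
  Submodule.span_mono (Set.image_mono (Set.preimage_mono h))

theorem X_smul_mem_quotientPart (j : Fin n) {q : MvPolynomial (Fin n) k ⧸ I}
    (hq : q ∈ quotientPart I A) :
    X (R := k) j • q ∈ quotientPart I ((Pi.single j 1 : Fin n → ℤ) +ᵥ A) := by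
  induction hq using Submodule.span_induction with
  | mem _ hx =>
    obtain ⟨u, hu, rfl⟩ := hx
    rw [X_smul_monomialClass]
    refine monomialClass_mem_quotientPart ?_
    rw [map_add, exponentDegree_single]
    exact Set.vadd_mem_vadd_set hu
  | zero => simp
  | add _ _ _ _ hx hy => rw [smul_add]; exact add_mem hx hy
  | smul a _ _ hx => rw [smul_comm]; exact Submodule.smul_mem _ a hx

theorem quotientPart_eq_span_standardBasis (hI : IsMonomialIdeal I) (A : Set (Fin n → ℤ)) :
    quotientPart I A =
      Submodule.span k (standardBasis hI '' {w | exponentDegree w.1 ∈ A}) := by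
  refine le_antisymm (Submodule.span_le.mpr ?_) (Submodule.span_mono ?_)
  · rintro _ ⟨u, hu, rfl⟩
    by_cases huI : monomial u (1 : k) ∈ I
    · rw [(monomialClass_eq_zero_iff I u).mpr huI]
      exact Submodule.zero_mem _
    · exact Submodule.subset_span ⟨⟨u, huI⟩, hu, standardBasis_apply hI _⟩
  · rintro _ ⟨w, hw, rfl⟩
    exact ⟨w, hw, (standardBasis_apply hI w).symm⟩

theorem mem_quotientPart_iff (hI : IsMonomialIdeal I) {q : MvPolynomial (Fin n) k ⧸ I} :
    q ∈ quotientPart I A ↔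
      ∀ w, (standardBasis hI).coord w q ≠ 0 → exponentDegree w.1 ∈ A := by
  rw [quotientPart_eq_span_standardBasis hI, Module.Basis.mem_span_image]
  exact ⟨fun h w hw => h (Finsupp.mem_support_iff.mpr hw),
    fun h w hw => h w (Finsupp.mem_support_iff.mp hw)⟩

theorem finrank_quotientPart (hI : IsMonomialIdeal I) (A : Set (Fin n → ℤ)) :
    Module.finrank k (quotientPart I A) =
      {w : StandardExponent I | exponentDegree w.1 ∈ A}.ncard := by
  rw [quotientPart_eq_span_standardBasis hI, finrank_span_basis_image]

variable (I)

/-- The `k`-linear maps `S → S ⧸ I` that are sums, possibly infinite, of maps homogeneous of a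
degree that belongs to `A`. -/
noncomputable def homPart (A : Set (Fin n → ℤ)) :
    Submodule k (MvPolynomial (Fin n) k →ₗ[k] MvPolynomial (Fin n) k ⧸ I) where
  carrier := {h | ∀ u, h (monomial u 1) ∈ quotientPart I (exponentDegree u +ᵥ A)}
  add_mem' hg hh u := add_mem (hg u) (hh u)
  zero_mem' _ := zero_mem _
  smul_mem' c _ hh u := Submodule.smul_mem _ c (hh u)

/-- The sum of the graded components of `End_k(S ⧸ I)` in the degrees that belong to `A`. -/
noncomputable def endPart (A : Set (Fin n → ℤ)) :
    Submodule k (Module.End k (MvPolynomial (Fin n) k ⧸ I)) :=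
  (homPart I A).comap (LinearMap.lcomp k _ (quotientProjection I))

variable {I}

theorem homPart_mono (h : A ⊆ B) : homPart I A ≤ homPart I B :=
  fun _ hh u => quotientPart_mono (Set.vadd_set_mono h) (hh u)

theorem mem_homPart_iff_of_commutators
    {h : MvPolynomial (Fin n) k →ₗ[k] MvPolynomial (Fin n) k ⧸ I} :
    h ∈ homPart I A ↔ h 1 ∈ quotientPart I A ∧ ∀ j, homCommutator (X (R := k) j) h ∈
      homPart I ((Pi.single j 1 : Fin n → ℤ) +ᵥ A) := by
  constructor
  · intro hh
    refine ⟨by simpa using hh 0, fun j u => ?_⟩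
    rw [homCommutator_apply, smul_eq_mul, X_mul_monomial]
    refine sub_mem ?_ ?_
    · rw [vadd_comm]
      exact X_smul_mem_quotientPart j (hh u)
    · have := hh (Finsupp.single j 1 + u)
      rwa [map_add, exponentDegree_single, add_comm, add_vadd] at this
  · rintro ⟨h_one, h_comm⟩ u
    induction u using exponent_induction with
    | zero => simpa using h_one
    | single_add j u hu =>
      have h_split : h (monomial (Finsupp.single j 1 + u) 1) =
          X (R := k) j • h (monomial u 1) - homCommutator (X (R := k) j) h (monomial u 1) := by
        rw [homCommutator_apply, sub_sub_cancel, smul_eq_mul, X_mul_monomial]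
      rw [h_split, map_add, exponentDegree_single, add_vadd]
      refine sub_mem (X_smul_mem_quotientPart j hu) ?_
      rw [vadd_comm]
      exact h_comm j u

theorem mem_endPart_iff (hI : IsMonomialIdeal I) {ψ : Module.End k (MvPolynomial (Fin n) k ⧸ I)} :
    ψ ∈ endPart I A ↔ ∀ v w : StandardExponent I,
      (standardBasis hI).coord w (ψ (standardBasis hI v)) ≠ 0 →
        exponentDegree w.1 - exponentDegree v.1 ∈ A := by
  have mem_iff (v w : Fin n →₀ ℕ) : exponentDegree w ∈ exponentDegree v +ᵥ A ↔
      exponentDegree w - exponentDegree v ∈ A := by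
    rw [Set.mem_vadd_set_iff_neg_vadd_mem, vadd_eq_add, neg_add_eq_sub]
  constructor
  · intro hψ v w hw
    rw [← mem_iff]
    refine (mem_quotientPart_iff hI).mp (hψ v.1) w ?_
    rwa [standardBasis_apply] at hw
  · intro hψ u
    change ψ (monomialClass I u) ∈ _
    by_cases hu : monomial u (1 : k) ∈ I
    · rw [(monomialClass_eq_zero_iff I u).mpr hu, map_zero]
      exact zero_mem _
    · refine (mem_quotientPart_iff hI).mpr fun w hw => (mem_iff u w).mpr (hψ ⟨u, hu⟩ w ?_)
      rwa [standardBasis_apply]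

theorem endPart_eq_span_matrixUnits [Fintype (StandardExponent I)]
    (hI : IsMonomialIdeal I) (A : Set (Fin n → ℤ)) :
    endPart I A = Submodule.span k ((standardBasis hI).end ''
      {p | exponentDegree p.1.1 - exponentDegree p.2.1 ∈ A}) := by
  ext ψ
  rw [mem_endPart_iff hI, Module.Basis.mem_span_image]
  constructor
  · rintro hψ ⟨w, v⟩ hp
    refine hψ v w ?_
    rwa [Finset.mem_coe, Finsupp.mem_support_iff, end_repr_apply] at hp
  · intro hψ v w hw
    refine hψ (a := (w, v)) ?_
    rwa [Finset.mem_coe, Finsupp.mem_support_iff, end_repr_apply]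

theorem finrank_endPart [Finite (StandardExponent I)]
    (hI : IsMonomialIdeal I) (A : Set (Fin n → ℤ)) :
    Module.finrank k (endPart I A) = {p : StandardExponent I × StandardExponent I |
      exponentDegree p.1.1 - exponentDegree p.2.1 ∈ A}.ncard := by
  cases nonempty_fintype (StandardExponent I)
  rw [endPart_eq_span_matrixUnits hI, finrank_span_basis_image]

theorem eq_zero_of_trace_mul_eq_zero [Finite (StandardExponent I)] (hI : IsMonomialIdeal I)
    {c : Module.End k (MvPolynomial (Fin n) k ⧸ I)} (hc : c ∈ endPart I A)
    (h : ∀ b ∈ endPart I (-A), LinearMap.trace k _ (c * b) = 0) : c = 0 := by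
  cases nonempty_fintype (StandardExponent I)
  refine (standardBasis hI).ext fun v => (standardBasis hI).ext_elem fun w => ?_
  by_contra hvw
  rw [LinearMap.zero_apply, map_zero, Finsupp.zero_apply] at hvw
  refine hvw ((trace_mul_end (standardBasis hI) c v w).symm.trans (h _ ?_))
  rw [endPart_eq_span_matrixUnits hI]
  refine Submodule.subset_span ⟨_, ?_, rfl⟩
  rw [Set.mem_ofPred_eq, Set.mem_neg, neg_sub]
  exact (mem_endPart_iff hI).mp hc v w hvw

open Classical in
/-- The projection of `S ⧸ I` onto the sum of its graded components in the degrees that belong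
to `A`. -/
noncomputable def quotientTruncation (hI : IsMonomialIdeal I) (A : Set (Fin n → ℤ)) :
    Module.End k (MvPolynomial (Fin n) k ⧸ I) :=
  (standardBasis hI).constr k fun w => if exponentDegree w.1 ∈ A then monomialClass I w else 0

open Classical in
theorem quotientTruncation_monomialClass (hI : IsMonomialIdeal I) (A : Set (Fin n → ℤ))
    (u : Fin n →₀ ℕ) : quotientTruncation hI A (monomialClass I u) =
      if exponentDegree u ∈ A then monomialClass I u else 0 := by
  by_cases hu : monomial u (1 : k) ∈ I
  · rw [(monomialClass_eq_zero_iff I u).mpr hu, map_zero, ite_self]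
  · rw [← standardBasis_apply hI ⟨u, hu⟩, quotientTruncation, Module.Basis.constr_basis,
      standardBasis_apply]

theorem quotientTruncation_mem (hI : IsMonomialIdeal I) (A : Set (Fin n → ℤ))
    (q : MvPolynomial (Fin n) k ⧸ I) : quotientTruncation hI A q ∈ quotientPart I A := by
  suffices h : ⊤ ≤ (quotientPart I A).comap (quotientTruncation hI A) from h Submodule.mem_top
  rw [← span_monomialClass, Submodule.span_le]
  rintro _ ⟨w, rfl⟩
  rw [SetLike.mem_coe, Submodule.mem_comap, quotientTruncation_monomialClass]
  split_ifs with hw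
  · exact monomialClass_mem_quotientPart hw
  · exact zero_mem _

theorem quotientTruncation_X_smul (hI : IsMonomialIdeal I) (A : Set (Fin n → ℤ)) (j : Fin n)
    (q : MvPolynomial (Fin n) k ⧸ I) :
    quotientTruncation hI ((Pi.single j 1 : Fin n → ℤ) +ᵥ A) (X (R := k) j • q) =
      X (R := k) j • quotientTruncation hI A q := by
  suffices h : quotientTruncation hI ((Pi.single j 1 : Fin n → ℤ) +ᵥ A) ∘ₗ
      Algebra.lsmul k k _ (X (R := k) j) =
        Algebra.lsmul k k _ (X (R := k) j) ∘ₗ quotientTruncation hI A from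
    LinearMap.congr_fun h q
  refine (standardBasis hI).ext fun w => ?_
  have mem_iff : exponentDegree (Finsupp.single j 1 + w.1) ∈ (Pi.single j 1 : Fin n → ℤ) +ᵥ A ↔
      exponentDegree w.1 ∈ A := by
    rw [map_add, exponentDegree_single]
    exact Set.vadd_mem_vadd_set_iff
  simp only [LinearMap.comp_apply, Algebra.lsmul_coe, standardBasis_apply, X_smul_monomialClass,
    quotientTruncation_monomialClass, smul_ite, smul_zero]
  classical exact if_congr mem_iff rfl rfl

theorem sum_quotientTruncation_singleton (hI : IsMonomialIdeal I) {F : Finset (Fin n → ℤ)}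
    {q : MvPolynomial (Fin n) k ⧸ I} (hq : q ∈ quotientPart I F) :
    ∑ γ ∈ F, quotientTruncation hI {γ} q = q := by
  suffices h : quotientPart I F ≤
      LinearMap.eqLocus (∑ γ ∈ F, quotientTruncation hI {γ}) LinearMap.id by
    simpa only [LinearMap.mem_eqLocus, LinearMap.sum_apply, LinearMap.id_apply] using h hq
  refine Submodule.span_le.mpr ?_
  rintro _ ⟨u, hu, rfl⟩
  simp only [SetLike.mem_coe, LinearMap.mem_eqLocus, LinearMap.sum_apply, LinearMap.id_apply,
    quotientTruncation_monomialClass, Set.mem_singleton_iff, Finset.sum_ite_eq]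
  exact if_pos hu

/-- The truncation of a `k`-linear map `S → S ⧸ I` that keeps its components of the degrees that
belong to `A`. -/
noncomputable def homTruncation (hI : IsMonomialIdeal I) (A : Set (Fin n → ℤ))
    (h : MvPolynomial (Fin n) k →ₗ[k] MvPolynomial (Fin n) k ⧸ I) :
    MvPolynomial (Fin n) k →ₗ[k] MvPolynomial (Fin n) k ⧸ I :=
  (basisMonomials (Fin n) k).constr k fun u =>
    quotientTruncation hI (exponentDegree u +ᵥ A) (h (monomial u 1))

theorem homTruncation_monomial (hI : IsMonomialIdeal I) (A : Set (Fin n → ℤ))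
    (h : MvPolynomial (Fin n) k →ₗ[k] MvPolynomial (Fin n) k ⧸ I) (u : Fin n →₀ ℕ) :
    homTruncation hI A h (monomial u 1) =
      quotientTruncation hI (exponentDegree u +ᵥ A) (h (monomial u 1)) :=
  (basisMonomials (Fin n) k).constr_basis k _ u

theorem homTruncation_mem_homPart (hI : IsMonomialIdeal I) (A : Set (Fin n → ℤ))
    (h : MvPolynomial (Fin n) k →ₗ[k] MvPolynomial (Fin n) k ⧸ I) :
    homTruncation hI A h ∈ homPart I A := fun u => by
  rw [homTruncation_monomial]
  exact quotientTruncation_mem hI _ _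

theorem homCommutator_homTruncation (hI : IsMonomialIdeal I) (A : Set (Fin n → ℤ))
    (h : MvPolynomial (Fin n) k →ₗ[k] MvPolynomial (Fin n) k ⧸ I) (j : Fin n) :
    homCommutator (X (R := k) j) (homTruncation hI A h) =
      homTruncation hI ((Pi.single j 1 : Fin n → ℤ) +ᵥ A) (homCommutator (X (R := k) j) h) := by
  refine (basisMonomials (Fin n) k).ext fun u => ?_
  simp only [coe_basisMonomials, homCommutator_apply, smul_eq_mul, X_mul_monomial,
    homTruncation_monomial, map_sub, map_add, exponentDegree_single, add_vadd,
    ← quotientTruncation_X_smul]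
  rw [vadd_comm]

variable (I)

/-- The `k`-linear maps `S → S ⧸ I` whose restriction to `I` is `S`-linear. -/
def idealLinear : Submodule k (MvPolynomial (Fin n) k →ₗ[k] MvPolynomial (Fin n) k ⧸ I) where
  carrier := {h | ∀ f, ∀ g ∈ I, h (f * g) = f • h g}
  add_mem' hh hh' f g hg := by
    rw [LinearMap.add_apply, hh f g hg, hh' f g hg, ← smul_add, LinearMap.add_apply]
  zero_mem' f g _ := (smul_zero f).symm
  smul_mem' c h hh f g hg := by
    rw [LinearMap.smul_apply, hh f g hg, smul_comm, LinearMap.smul_apply]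

variable {I}

theorem mem_idealLinear_iff {h : MvPolynomial (Fin n) k →ₗ[k] MvPolynomial (Fin n) k ⧸ I} :
    h ∈ idealLinear I ↔ ∀ j : Fin n, ∀ g ∈ I, homCommutator (X (R := k) j) h g = 0 := by
  refine ⟨fun hh j g hg => sub_eq_zero.mpr (hh (X j) g hg).symm, fun hh f g hg => ?_⟩
  exact map_smul_of_map_X_smul (N := I) (h ∘ₗ I.subtype.restrictScalars k)
    (fun j x => (sub_eq_zero.mp (hh j x x.2)).symm) f ⟨g, hg⟩

theorem homTruncation_mem_idealLinear (hI : IsMonomialIdeal I) (A : Set (Fin n → ℤ))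
    {h : MvPolynomial (Fin n) k →ₗ[k] MvPolynomial (Fin n) k ⧸ I} (hh : h ∈ idealLinear I) :
    homTruncation hI A h ∈ idealLinear I := by
  refine mem_idealLinear_iff.mpr fun j g hg => hI.map_eq_zero (fun u hu => ?_) hg
  rw [homCommutator_homTruncation, homTruncation_monomial, mem_idealLinear_iff.mp hh j _ hu,
    map_zero]

/-- The restriction to `I` of a `k`-linear map `S → S ⧸ I` that is `S`-linear on `I`. -/
noncomputable def restrictToIdeal {h : MvPolynomial (Fin n) k →ₗ[k] MvPolynomial (Fin n) k ⧸ I}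
    (hh : h ∈ idealLinear I) : TangentSpaceAt I where
  toFun f := h f
  map_add' f g := map_add h (f : MvPolynomial (Fin n) k) g
  map_smul' f g := hh f g g.2

variable (I) in
open Classical in
/-- The `k`-linear map `S → I` that fixes the monomials in `I` and kills all others. -/
noncomputable def idealProjection : MvPolynomial (Fin n) k →ₗ[k] I :=
  (basisMonomials (Fin n) k).constr k fun u =>
    if hu : monomial u (1 : k) ∈ I then ⟨monomial u 1, hu⟩ else 0

theorem idealProjection_monomial_of_mem {u : Fin n →₀ ℕ} (hu : monomial u (1 : k) ∈ I) :
    idealProjection I (monomial u 1) = ⟨monomial u 1, hu⟩ :=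
  ((basisMonomials (Fin n) k).constr_basis k _ u).trans (dif_pos hu)

theorem idealProjection_monomial_of_notMem {u : Fin n →₀ ℕ} (hu : monomial u (1 : k) ∉ I) :
    idealProjection I (monomial u 1) = 0 :=
  ((basisMonomials (Fin n) k).constr_basis k _ u).trans (dif_neg hu)

theorem idealProjection_of_mem (hI : IsMonomialIdeal I) {f : MvPolynomial (Fin n) k} (hf : f ∈ I) :
    idealProjection I f = ⟨f, hf⟩ := by
  refine Subtype.ext (sub_eq_zero.mp ?_)
  refine hI.map_eq_zero (h := (I.subtype.restrictScalars k) ∘ₗ idealProjection I - LinearMap.id)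
    (fun u hu => ?_) hf
  simp [idealProjection_monomial_of_mem hu]

variable (I) in
/-- The extension by zero of a tangent vector `I → S ⧸ I` to a `k`-linear map on `S`. -/
noncomputable def tangentExtension :
    TangentSpaceAt I →ₗ[k] MvPolynomial (Fin n) k →ₗ[k] MvPolynomial (Fin n) k ⧸ I where
  toFun φ := φ.restrictScalars k ∘ₗ idealProjection I
  map_add' _ _ := rfl
  map_smul' _ _ := rfl

theorem tangentExtension_of_mem (hI : IsMonomialIdeal I) (φ : TangentSpaceAt I)
    {f : MvPolynomial (Fin n) k} (hf : f ∈ I) : tangentExtension I φ f = φ ⟨f, hf⟩ :=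
  congrArg φ (idealProjection_of_mem hI hf)

theorem tangentExtension_mem_idealLinear (hI : IsMonomialIdeal I) (φ : TangentSpaceAt I) :
    tangentExtension I φ ∈ idealLinear I := fun f g hg => by
  rw [tangentExtension_of_mem hI φ hg, tangentExtension_of_mem hI φ (I.mul_mem_left f hg),
    ← map_smul]
  rfl

variable (I)

/-- The sum of the graded components of `T(I)` in the degrees that belong to `A`. -/
noncomputable def tangentPart (A : Set (Fin n → ℤ)) : Submodule k (TangentSpaceAt I) :=
  ⨆ α ∈ A, tangentPiece I α

variable {I}

theorem tangentExtension_mem_homPart (hI : IsMonomialIdeal I) {φ : TangentSpaceAt I}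
    (hφ : ∀ u (hu : monomial u (1 : k) ∈ I),
      φ ⟨monomial u 1, hu⟩ ∈ quotientPart I (exponentDegree u +ᵥ A)) :
    tangentExtension I φ ∈ homPart I A := fun u => by
  by_cases hu : monomial u (1 : k) ∈ I
  · rw [tangentExtension_of_mem hI φ hu]
    exact hφ u hu
  · have : tangentExtension I φ (monomial u 1) = 0 :=
      (congrArg φ (idealProjection_monomial_of_notMem hu)).trans (map_zero φ)
    rw [this]
    exact zero_mem _

theorem tangentPiece_eq_comap_homPart (hI : IsMonomialIdeal I) (α : Fin n → ℤ) :
    tangentPiece I α = (homPart I {α}).comap (tangentExtension I) := by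
  have degree_eq (u : Fin n →₀ ℕ) : quotientPart I (exponentDegree u +ᵥ ({α} : Set (Fin n → ℤ))) =
      quotientPiece I (α + exponentDegree u) := by
    rw [Set.vadd_set_singleton, vadd_eq_add, add_comm, quotientPiece_eq_quotientPart]
  refine le_antisymm (fun φ hφ => ?_) fun φ hφ β f hf => ?_
  · refine tangentExtension_mem_homPart hI fun u hu => ?_
    rw [degree_eq]
    exact hφ _ ⟨_, hu⟩ (Submodule.subset_span ⟨u, fun _ => rfl, rfl⟩)
  · suffices h : polyPiece k β ≤ (quotientPiece I (α + β)).comap (tangentExtension I φ) by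
      rw [← Subtype.coe_eta f f.2, ← tangentExtension_of_mem hI]
      exact h hf
    refine Submodule.span_le.mpr ?_
    rintro _ ⟨u, hu, rfl⟩
    rw [← show exponentDegree u = β from funext hu, ← degree_eq]
    exact hφ u

theorem exists_finset_subset_degrees [Finite (StandardExponent I)] (hI : IsMonomialIdeal I)
    {h : MvPolynomial (Fin n) k →ₗ[k] MvPolynomial (Fin n) k ⧸ I} (hh : h ∈ homPart I A)
    (U : Finset (Fin n →₀ ℕ)) :
    ∃ F : Finset (Fin n → ℤ), ↑F ⊆ A ∧
      ∀ u ∈ U, h (monomial u 1) ∈ quotientPart I (exponentDegree u +ᵥ (F : Set (Fin n → ℤ))) := by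
  cases nonempty_fintype (StandardExponent I)
  classical
  let D := (Finset.univ ×ˢ U).image fun p : StandardExponent I × (Fin n →₀ ℕ) =>
    -exponentDegree p.2 + exponentDegree p.1.1
  refine ⟨D.filter (· ∈ A), fun α hα => (Finset.mem_filter.mp hα).2, fun u hu => ?_⟩
  refine (mem_quotientPart_iff hI).mpr fun w hw => ?_
  have hwA := (mem_quotientPart_iff hI).mp (hh u) w hw
  rw [Set.mem_vadd_set_iff_neg_vadd_mem] at hwA ⊢
  exact Finset.mem_filter.mpr ⟨Finset.mem_image.mpr
    ⟨(w, u), Finset.mem_product.mpr ⟨Finset.mem_univ w, hu⟩, rfl⟩, hwA⟩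

theorem sum_homTruncation_monomial (hI : IsMonomialIdeal I) {F : Finset (Fin n → ℤ)}
    {h : MvPolynomial (Fin n) k →ₗ[k] MvPolynomial (Fin n) k ⧸ I} {u : Fin n →₀ ℕ}
    (hu : h (monomial u 1) ∈ quotientPart I (exponentDegree u +ᵥ (F : Set (Fin n → ℤ)))) :
    ∑ α ∈ F, homTruncation hI {α} h (monomial u 1) = h (monomial u 1) := by
  rw [← Finset.coe_vadd_finset] at hu
  conv_rhs => rw [← sum_quotientTruncation_singleton hI hu]
  simp only [homTruncation_monomial, Set.vadd_set_singleton]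
  rw [Finset.vadd_finset_def, Finset.sum_image (by simp)]

theorem tangentPart_eq_comap_homPart [Finite (StandardExponent I)] (hI : IsMonomialIdeal I)
    (A : Set (Fin n → ℤ)) :
    tangentPart I A = (homPart I A).comap (tangentExtension I) := by
  refine le_antisymm (iSup₂_le fun α hα => ?_) fun φ hφ => ?_
  · rw [tangentPiece_eq_comap_homPart hI]
    exact Submodule.comap_mono (homPart_mono (Set.singleton_subset_iff.mpr hα))
  obtain ⟨G, hG⟩ := IsNoetherian.noetherian (⊤ : Submodule (MvPolynomial (Fin n) k) I)
  obtain ⟨F, hFA, hF⟩ := exists_finset_subset_degrees hI hφ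
    (G.biUnion fun g => (g : MvPolynomial (Fin n) k).support)
  let component (α : Fin n → ℤ) : TangentSpaceAt I := restrictToIdeal <|
    homTruncation_mem_idealLinear hI {α} (tangentExtension_mem_idealLinear hI φ)
  have sum_component : ∑ α ∈ F, component α = φ := by
    refine LinearMap.ext_on hG fun g hg => ?_
    suffices h : (∑ α ∈ F, homTruncation hI {α} (tangentExtension I φ) - tangentExtension I φ)
        (g : MvPolynomial (Fin n) k) = 0 by
      rw [LinearMap.sub_apply, LinearMap.sum_apply, tangentExtension_of_mem hI φ g.2,
        sub_eq_zero] at h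
      rw [LinearMap.sum_apply]
      exact h
    refine map_eq_zero_of_support fun u hu => ?_
    rw [LinearMap.sub_apply, LinearMap.sum_apply,
      sum_homTruncation_monomial hI (hF u (Finset.mem_biUnion.mpr ⟨g, hg, hu⟩)), sub_self]
  have component_mem (α) : component α ∈ tangentPiece I α := by
    rw [tangentPiece_eq_comap_homPart hI]
    exact tangentExtension_mem_homPart hI fun u _ => homTruncation_mem_homPart hI {α} _ u
  rw [← sum_component]
  exact sum_mem fun α hα =>
    Submodule.mem_iSup_of_mem α (Submodule.mem_iSup_of_mem (hFA hα) (component_mem α))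

theorem finite_tangentSpaceAt [Module.Finite k (MvPolynomial (Fin n) k ⧸ I)] :
    Module.Finite k (TangentSpaceAt I) := by
  obtain ⟨G, hG⟩ := IsNoetherian.noetherian (⊤ : Submodule (MvPolynomial (Fin n) k) I)
  let evaluation : TangentSpaceAt I →ₗ[k] G → MvPolynomial (Fin n) k ⧸ I :=
    { toFun := fun φ g => φ g
      map_add' := fun _ _ => rfl
      map_smul' := fun _ _ => rfl }
  exact Module.Finite.of_injective evaluation fun φ ψ h =>
    LinearMap.ext_on hG fun g hg => congrFun h ⟨g, hg⟩

theorem isCompl_tangentPart_compl [Finite (StandardExponent I)] (hI : IsMonomialIdeal I)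
    (A : Set (Fin n → ℤ)) : IsCompl (tangentPart I A) (tangentPart I Aᶜ) := by
  refine ⟨Submodule.disjoint_def.mpr fun φ hφ hφ' => ?_, codisjoint_iff.mpr ?_⟩
  · rw [tangentPart_eq_comap_homPart hI] at hφ hφ'
    ext1 f
    rw [← tangentExtension_of_mem hI φ f.2]
    refine map_eq_zero_of_support fun u _ => (standardBasis hI).ext_elem fun w => ?_
    by_contra hw
    rw [map_zero, Finsupp.zero_apply] at hw
    have mem := (mem_quotientPart_iff hI).mp (hφ u) w hw
    have mem_compl := (mem_quotientPart_iff hI).mp (hφ' u) w hw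
    rw [Set.vadd_set_compl] at mem_compl
    exact mem_compl mem
  · rw [tangentPart, tangentPart, ← iSup_union, Set.union_compl_self]
    change tangentPart I Set.univ = ⊤
    rw [tangentPart_eq_comap_homPart hI, eq_top_iff]
    intro φ _ u
    exact (mem_quotientPart_iff hI).mpr fun w _ => by simp

theorem exists_comp_quotientProjection_eq {M : Type*} [AddCommGroup M] [Module k M]
    {h : MvPolynomial (Fin n) k →ₗ[k] M} (hh : ∀ f ∈ I, h f = 0) :
    ∃ ψ : MvPolynomial (Fin n) k ⧸ I →ₗ[k] M, ψ ∘ₗ quotientProjection I = h :=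
  ⟨(I.restrictScalars k).liftQ h hh, rfl⟩

theorem lcomp_quotientProjection_injective (M : Type*) [AddCommGroup M] [Module k M] :
    Function.Injective (LinearMap.lcomp k M (quotientProjection I)) := fun _ _ h =>
  (LinearMap.cancel_right (Ideal.Quotient.mkₐ_surjective k I)).mp h

theorem homCommutator_comp_quotientProjection {M : Type*} [AddCommGroup M] [Module k M]
    [Module (MvPolynomial (Fin n) k) M] [IsScalarTower k (MvPolynomial (Fin n) k) M]
    (f : MvPolynomial (Fin n) k) (ψ : MvPolynomial (Fin n) k ⧸ I →ₗ[k] M) :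
    homCommutator f (ψ ∘ₗ quotientProjection I) = homCommutator f ψ ∘ₗ quotientProjection I :=
  homCommutator_comp ψ fun _ => rfl

variable (I) in
/-- The `k`-linear maps `S → S ⧸ I` of degrees in `A` that restrict to tangent vectors on `I`. -/
noncomputable def extensionPart (A : Set (Fin n → ℤ)) :
    Submodule k (MvPolynomial (Fin n) k →ₗ[k] MvPolynomial (Fin n) k ⧸ I) :=
  homPart I A ⊓ idealLinear I

theorem tangentExtension_injective (hI : IsMonomialIdeal I) :
    Function.Injective (tangentExtension I) := fun φ ψ h => by
  ext1 f
  rw [← tangentExtension_of_mem hI φ f.2, h, tangentExtension_of_mem hI ψ f.2]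

theorem comp_quotientProjection_apply_of_mem {M : Type*} [AddCommGroup M] [Module k M]
    (ψ : MvPolynomial (Fin n) k ⧸ I →ₗ[k] M) {f : MvPolynomial (Fin n) k} (hf : f ∈ I) :
    (ψ ∘ₗ quotientProjection I) f = 0 :=
  (congrArg ψ (Ideal.Quotient.eq_zero_iff_mem.mpr hf)).trans (map_zero ψ)

theorem extensionPart_eq_sup [Finite (StandardExponent I)] (hI : IsMonomialIdeal I)
    (A : Set (Fin n → ℤ)) :
    extensionPart I A = (tangentPart I A).map (tangentExtension I) ⊔
      (endPart I A).map (LinearMap.lcomp k _ (quotientProjection I)) := by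
  refine le_antisymm ?_ (sup_le ?_ ?_)
  · rintro h ⟨hA, hlin⟩
    have restrict_mem : restrictToIdeal hlin ∈ tangentPart I A := by
      rw [tangentPart_eq_comap_homPart hI]
      exact tangentExtension_mem_homPart hI fun u _ => hA u
    obtain ⟨ψ, hψ⟩ := exists_comp_quotientProjection_eq (I := I)
      (h := h - tangentExtension I (restrictToIdeal hlin)) fun f hf => by
        rw [LinearMap.sub_apply, tangentExtension_of_mem hI _ hf]
        exact sub_self _
    refine Submodule.mem_sup.mpr ⟨_, ⟨_, restrict_mem, rfl⟩, _, ⟨ψ, ?_, rfl⟩, ?_⟩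
    · change ψ ∘ₗ quotientProjection I ∈ homPart I A
      rw [tangentPart_eq_comap_homPart hI] at restrict_mem
      rw [hψ]
      exact sub_mem hA restrict_mem
    · rw [LinearMap.lcomp_apply', hψ, add_sub_cancel]
  · rintro _ ⟨φ, hφ, rfl⟩
    rw [tangentPart_eq_comap_homPart hI] at hφ
    exact ⟨hφ, tangentExtension_mem_idealLinear hI φ⟩
  · rintro _ ⟨ψ, hψ, rfl⟩
    refine ⟨hψ, fun f g hg => ?_⟩
    rw [LinearMap.lcomp_apply', comp_quotientProjection_apply_of_mem ψ hg, smul_zero,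
      comp_quotientProjection_apply_of_mem ψ (I.mul_mem_left f hg)]

theorem disjoint_range_tangentExtension (hI : IsMonomialIdeal I) :
    Disjoint (LinearMap.range (tangentExtension I))
      (LinearMap.range (LinearMap.lcomp k _ (quotientProjection I))) := by
  rw [Submodule.disjoint_def]
  rintro _ ⟨φ, rfl⟩ ⟨ψ, hψ⟩
  suffices h : φ = 0 by rw [h, map_zero]
  ext1 f
  rw [← tangentExtension_of_mem hI φ f.2, ← hψ]
  exact comp_quotientProjection_apply_of_mem ψ f.2

theorem finrank_extensionPart [Finite (StandardExponent I)] (hI : IsMonomialIdeal I)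
    (A : Set (Fin n → ℤ)) :
    Module.finrank k (extensionPart I A) =
      Module.finrank k (tangentPart I A) + Module.finrank k (endPart I A) := by
  have := Module.Finite.of_basis (standardBasis hI)
  have := finite_tangentSpaceAt (I := I)
  have disjoint := (disjoint_range_tangentExtension hI).mono
    (LinearMap.map_le_range (p := tangentPart I A)) (LinearMap.map_le_range (p := endPart I A))
  have finrank_sup := Submodule.finrank_sup_add_finrank_inf_eq
    ((tangentPart I A).map (tangentExtension I))
    ((endPart I A).map (LinearMap.lcomp k _ (quotientProjection I)))
  rwa [← extensionPart_eq_sup hI, disjoint.eq_bot, finrank_bot, add_zero,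
    ← (Submodule.equivMapOfInjective _ (tangentExtension_injective hI) _).finrank_eq,
    ← (Submodule.equivMapOfInjective _ (lcomp_quotientProjection_injective _) _).finrank_eq]
    at finrank_sup

variable (I) in
/-- The families `(a_j)` of endomorphisms of `S ⧸ I`, with `a_j` of degrees in `e_j + A`, that
satisfy the integrability condition `[X_i, a_j] = [X_j, a_i]`. -/
noncomputable def closedSystems (A : Set (Fin n → ℤ)) :
    Submodule k (∀ j : Fin n, endPart I ((Pi.single j 1 : Fin n → ℤ) +ᵥ A)) where
  carrier := {a | ∀ i j : Fin n,
    homCommutator (X (R := k) i) (a j).1 = homCommutator (X (R := k) j) (a i).1}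
  add_mem' {a b} ha hb i j := by
    simp only [Pi.add_apply, Submodule.coe_add, map_add, ha i j, hb i j]
  zero_mem' i j := by simp
  smul_mem' c a ha i j := by simp only [Pi.smul_apply, Submodule.coe_smul, map_smul, ha i j]

variable (I) in
/-- The map `h ↦ (([X_j, h])_j, h 1)` on the `k`-linear maps `S → S ⧸ I`. -/
noncomputable def differential :
    (MvPolynomial (Fin n) k →ₗ[k] MvPolynomial (Fin n) k ⧸ I) →ₗ[k]
      (Fin n → MvPolynomial (Fin n) k →ₗ[k] MvPolynomial (Fin n) k ⧸ I) ×
        (MvPolynomial (Fin n) k ⧸ I) :=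
  (LinearMap.pi fun j => homCommutator (X (R := k) j)).prod (LinearMap.applyₗ 1)

theorem differential_injective : Function.Injective (differential I) := by
  refine (injective_iff_map_eq_zero _).mpr fun h hh => LinearMap.ext fun f => ?_
  obtain ⟨comm_eq_zero, one_eq_zero⟩ := Prod.ext_iff.mp hh
  have map_smul := map_smul_of_map_X_smul h (fun j x => (sub_eq_zero.mp
    (LinearMap.congr_fun (congrFun comm_eq_zero j) x)).symm) f 1
  rw [smul_eq_mul, mul_one] at map_smul
  rw [map_smul]
  exact (congrArg (f • ·) one_eq_zero).trans (smul_zero f)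

variable (I) in
/-- The pullback of families of endomorphisms of `S ⧸ I` along `S → S ⧸ I`. -/
noncomputable def pullback (A : Set (Fin n → ℤ)) :
    (∀ j : Fin n, endPart I ((Pi.single j 1 : Fin n → ℤ) +ᵥ A)) →ₗ[k]
      Fin n → MvPolynomial (Fin n) k →ₗ[k] MvPolynomial (Fin n) k ⧸ I :=
  LinearMap.pi fun j =>
    LinearMap.lcomp k _ (quotientProjection I) ∘ₗ Submodule.subtype _ ∘ₗ LinearMap.proj j

theorem pullback_injective (A : Set (Fin n → ℤ)) : Function.Injective (pullback I A) :=
  fun _ _ h => _root_.funext fun j =>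
    Subtype.ext (lcomp_quotientProjection_injective _ (congrFun h j))

theorem differential_mem_range_of_mem_extensionPart
    {h : MvPolynomial (Fin n) k →ₗ[k] MvPolynomial (Fin n) k ⧸ I} (hh : h ∈ extensionPart I A) :
    (differential I h).1 ∈ (closedSystems I A).map (pullback I A) := by
  choose a ha using fun j => exists_comp_quotientProjection_eq (mem_idealLinear_iff.mp hh.2 j)
  have a_mem (j : Fin n) : a j ∈ endPart I ((Pi.single j 1 : Fin n → ℤ) +ᵥ A) := by
    change a j ∘ₗ quotientProjection I ∈ homPart I _
    rw [ha]
    exact (mem_homPart_iff_of_commutators.mp hh.1).2 j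
  refine ⟨fun j => ⟨a j, a_mem j⟩, fun i j => ?_, _root_.funext ha⟩
  refine lcomp_quotientProjection_injective _ ?_
  simp only [LinearMap.lcomp_apply', ← homCommutator_comp_quotientProjection, ha]
  exact homCommutator_comm _ _ h

theorem exists_differential_eq {a : ∀ j : Fin n, endPart I ((Pi.single j 1 : Fin n → ℤ) +ᵥ A)}
    (ha : a ∈ closedSystems I A) {m : MvPolynomial (Fin n) k ⧸ I} (hm : m ∈ quotientPart I A) :
    ∃ h ∈ extensionPart I A, differential I h = (pullback I A a, m) := by
  obtain ⟨h, h_one, h_comm⟩ := exists_homCommutator_X_eq (fun j => (a j).1) ha m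
    (quotientProjection I 1)
  have comm_eq (j : Fin n) :
      homCommutator (X (R := k) j) h = (a j).1 ∘ₗ quotientProjection I :=
    LinearMap.ext fun f => by
      have smul_one : f • quotientProjection I 1 = quotientProjection I f :=
        congrArg (quotientProjection I) (mul_one f)
      rw [h_comm, smul_one, LinearMap.comp_apply]
  refine ⟨h, ⟨mem_homPart_iff_of_commutators.mpr ⟨h_one ▸ hm, fun j => ?_⟩,
    mem_idealLinear_iff.mpr fun j g hg => ?_⟩, Prod.ext (_root_.funext comm_eq) h_one⟩
  · rw [comm_eq]
    exact (a j).2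
  · rw [comm_eq, comp_quotientProjection_apply_of_mem _ hg]

theorem map_differential_extensionPart (A : Set (Fin n → ℤ)) :
    (extensionPart I A).map (differential I) =
      ((closedSystems I A).map (pullback I A)).prod (quotientPart I A) := by
  apply le_antisymm
  · rintro _ ⟨h, hh, rfl⟩
    exact ⟨differential_mem_range_of_mem_extensionPart hh,
      (mem_homPart_iff_of_commutators.mp hh.1).1⟩
  · rintro ⟨_, m⟩ ⟨⟨a, ha, rfl⟩, hm⟩
    exact exists_differential_eq ha hm

set_option maxSynthPendingDepth 3 in
theorem finrank_extensionPart_eq_closedSystems [Module.Finite k (MvPolynomial (Fin n) k ⧸ I)]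
    (A : Set (Fin n → ℤ)) :
    Module.finrank k (extensionPart I A) =
      Module.finrank k (closedSystems I A) + Module.finrank k (quotientPart I A) := by
  rw [(Submodule.equivMapOfInjective _ differential_injective _).finrank_eq,
    map_differential_extensionPart, finrank_submodule_prod,
    ← (Submodule.equivMapOfInjective _ (pullback_injective A) _).finrank_eq]

theorem finrank_tangentPart_add_finrank_endPart [Finite (StandardExponent I)]
    (hI : IsMonomialIdeal I) (A : Set (Fin n → ℤ)) :
    Module.finrank k (tangentPart I A) + Module.finrank k (endPart I A) =
      Module.finrank k (closedSystems I A) + Module.finrank k (quotientPart I A) := by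
  have := Module.Finite.of_basis (standardBasis hI)
  rw [← finrank_extensionPart hI, finrank_extensionPart_eq_closedSystems]

theorem homCommutator_mem_endPart {ψ : Module.End k (MvPolynomial (Fin n) k ⧸ I)}
    (hψ : ψ ∈ endPart I A) (j : Fin n) :
    homCommutator (X (R := k) j) ψ ∈ endPart I ((Pi.single j 1 : Fin n → ℤ) +ᵥ A) := by
  change homCommutator (X (R := k) j) ψ ∘ₗ quotientProjection I ∈ homPart I _
  rw [← homCommutator_comp_quotientProjection]
  exact (mem_homPart_iff_of_commutators.mp hψ).2 j

/-- The set `-(1, …, 1) - A` of degrees, which is dual to `A` under the pairing `curlForm`. -/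
def dualDegrees (A : Set (Fin n → ℤ)) : Set (Fin n → ℤ) := -((1 : Fin n → ℤ) +ᵥ A)

theorem mem_dualDegrees {δ : Fin n → ℤ} : δ ∈ dualDegrees A ↔ -1 - δ ∈ A := by
  rw [dualDegrees, Set.mem_neg, Set.mem_vadd_set_iff_neg_vadd_mem, vadd_eq_add, sub_eq_add_neg]

theorem dualDegrees_dualDegrees (A : Set (Fin n → ℤ)) : dualDegrees (dualDegrees A) = A := by
  ext δ
  rw [mem_dualDegrees, mem_dualDegrees, sub_sub_cancel]

theorem finrank_endPart_neg [Finite (StandardExponent I)] (hI : IsMonomialIdeal I)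
    (A : Set (Fin n → ℤ)) :
    Module.finrank k (endPart I (-A)) = Module.finrank k (endPart I A) := by
  rw [finrank_endPart hI, finrank_endPart hI, ← Set.ncard_image_of_injective _ Prod.swap_injective,
    Set.image_swap_eq_preimage_swap]
  simp only [Set.mem_neg, neg_sub, Set.preimage_ofPred_eq, Prod.fst_swap, Prod.snd_swap]

theorem finrank_endPart_eq_sum_indicator [Fintype (StandardExponent I)] (hI : IsMonomialIdeal I)
    (A : Set (Fin n → ℤ)) :
    (Module.finrank k (endPart I A) : ℤ) = ∑ p : StandardExponent I × StandardExponent I,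
      A.indicator 1 (exponentDegree p.1.1 - exponentDegree p.2.1) := by
  classical
  rw [finrank_endPart hI, Set.ncard_eq_toFinset_card', Set.toFinset_ofPred, Finset.card_filter]
  simp only [Nat.cast_sum, Nat.cast_ite, Nat.cast_one, Nat.cast_zero, Set.indicator_apply,
    Pi.one_apply]

theorem indicator_vadd_univ_pi_one (c : Fin n → ℤ) (U : Fin n → Set ℤ) (δ : Fin n → ℤ) :
    (c +ᵥ Set.univ.pi U).indicator (1 : (Fin n → ℤ) → ℤ) δ =
      ∏ i, (U i).indicator 1 (δ i - c i) := by
  classical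
  have indicator_vadd : (c +ᵥ Set.univ.pi U).indicator (1 : (Fin n → ℤ) → ℤ) δ =
      (Set.univ.pi U).indicator 1 (δ - c) := by
    simp only [Set.indicator_apply, Set.mem_vadd_set_iff_neg_vadd_mem, vadd_eq_add,
      neg_add_eq_sub, Pi.one_apply]
  rw [indicator_vadd, ← Finset.coe_univ, Set.indicator_pi_one_apply]
  rfl

/-- The backward difference `1_U(a) - 1_U(a - 1)` of the indicator function of `U`. -/
noncomputable def indicatorJump (U : Set ℤ) (a : ℤ) : ℤ := U.indicator 1 a - U.indicator 1 (a - 1)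

theorem indicatorJump_univ (a : ℤ) : indicatorJump Set.univ a = 0 := by
  simp [indicatorJump]

/-- The letter whose condition is the complementary one. -/
def SignLetter.opposite : SignLetter → SignLetter
  | .p => .n
  | .n => .p

/-- The sign `±1` of the jump at `0` of the condition that a letter stands for. -/
def SignLetter.sign : SignLetter → ℤ
  | .p => 1
  | .n => -1

theorem SignLetter.opposite_admits_iff (l : SignLetter) (a : ℤ) :
    l.opposite.Admits a ↔ l.Admits (-1 - a) := by
  cases l <;> simp only [opposite, Admits] <;> lia

theorem SignLetter.indicatorJump_admits (l : SignLetter) (a : ℤ) :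
    indicatorJump {a | l.Admits a} a = if a = 0 then l.sign else 0 := by
  cases l <;> simp only [indicatorJump, Set.indicator_apply, Set.mem_ofPred_eq, Admits, sign,
    Pi.one_apply] <;> split_ifs <;> lia

theorem dualDegrees_signatureDegrees (s : Fin n → SignLetter) :
    dualDegrees (signatureDegrees s) = signatureDegrees (SignLetter.opposite ∘ s) := by
  ext δ
  rw [mem_dualDegrees]
  exact forall_congr' fun i => ((s i).opposite_admits_iff (δ i)).symm

theorem signatureDegrees_eq_univ_pi (s : Fin n → SignLetter) :
    signatureDegrees s = Set.univ.pi fun i => {a | (s i).Admits a} := by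
  ext δ
  exact Set.mem_univ_pi.symm

theorem finrank_quotientPart_eq_zero (hI : IsMonomialIdeal I) {i : Fin n}
    (hA : ∀ δ ∈ A, δ i < 0) : Module.finrank k (quotientPart I A) = 0 := by
  have eq_empty : {w : StandardExponent I | exponentDegree w.1 ∈ A} = ∅ :=
    Set.eq_empty_of_forall_notMem fun w hw => (hA _ hw).not_ge (Int.natCast_nonneg _)
  rw [finrank_quotientPart hI, eq_empty, Set.ncard_empty]

theorem finrank_quotientPart_eq_finrank (hI : IsMonomialIdeal I)
    (hA : ∀ u, exponentDegree u ∈ A) :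
    Module.finrank k (quotientPart I A) = Module.finrank k (MvPolynomial (Fin n) k ⧸ I) := by
  rw [finrank_quotientPart hI, Module.finrank_eq_nat_card_basis (standardBasis hI),
    ← Set.ncard_univ]
  exact congrArg _ (Set.eq_univ_of_forall fun w => hA w.1)

theorem sum_prod_indicatorJump_admits [Fintype (StandardExponent I)] (hI : IsMonomialIdeal I)
    (s : Fin n → SignLetter) :
    ∑ p : StandardExponent I × StandardExponent I,
        ∏ i, indicatorJump {a | (s i).Admits a} (exponentDegree p.1.1 i - exponentDegree p.2.1 i) =
      Module.finrank k (MvPolynomial (Fin n) k ⧸ I) * ∏ i, (s i).sign := by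
  have eq_iff (v w : StandardExponent I) :
      (∀ i, exponentDegree v.1 i - exponentDegree w.1 i = 0) ↔ v = w := by
    simp only [sub_eq_zero, ← _root_.funext_iff, exponentDegree_injective.eq_iff, Subtype.ext_iff]
  simp only [SignLetter.indicatorJump_admits, Finset.prod_ite_zero, Finset.mem_univ, true_imp_iff,
    eq_iff, Fintype.sum_prod_type, Finset.sum_ite_eq, if_true, Finset.sum_const, nsmul_eq_mul,
    Finset.card_univ, Module.finrank_eq_card_basis (standardBasis hI)]

section ThreeVariables

variable {I : Ideal (MvPolynomial (Fin 3) k)}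

theorem single_vadd_dualDegrees (A : Set (Fin 3 → ℤ)) (i : Fin 3) :
    (Pi.single i 1 : Fin 3 → ℤ) +ᵥ dualDegrees A =
      -((Pi.single (i + 1) 1 : Fin 3 → ℤ) +ᵥ (Pi.single (i + 2) 1 : Fin 3 → ℤ) +ᵥ A) := by
  have sum_single :
      (Pi.single i 1 + Pi.single (i + 1) 1 + Pi.single (i + 2) 1 : Fin 3 → ℤ) = 1 := by
    fin_cases i <;> decide
  ext δ
  rw [Set.mem_vadd_set_iff_neg_vadd_mem, mem_dualDegrees, Set.mem_neg,
    Set.mem_vadd_set_iff_neg_vadd_mem, Set.mem_vadd_set_iff_neg_vadd_mem, ← sum_single]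
  simp only [vadd_eq_add]
  convert Iff.rfl using 2
  abel

theorem ker_curlForm_eq_closedSystems [Finite (StandardExponent I)] (hI : IsMonomialIdeal I)
    (A : Set (Fin 3 → ℤ)) :
    LinearMap.ker (curlForm (X (R := k)) (fun j => endPart I ((Pi.single j 1 : Fin 3 → ℤ) +ᵥ A))
      fun j => endPart I ((Pi.single j 1 : Fin 3 → ℤ) +ᵥ dualDegrees A)) = closedSystems I A := by
  ext a
  refine Iff.trans ⟨fun ha => _root_.funext fun i => ?_, fun ha => LinearMap.ext fun b => ?_⟩
    (curl_eq_zero_iff (X (R := k)))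
  · have curl_mem : curl (X (R := k)) (fun j => (a j).1) i ∈ endPart I
        ((Pi.single (i + 1) 1 : Fin 3 → ℤ) +ᵥ (Pi.single (i + 2) 1 : Fin 3 → ℤ) +ᵥ A) := by
      refine sub_mem (homCommutator_mem_endPart (a (i + 2)).2 _) ?_
      rw [vadd_comm]
      exact homCommutator_mem_endPart (a (i + 1)).2 _
    refine eq_zero_of_trace_mul_eq_zero hI curl_mem fun b hb => ?_
    rw [← single_vadd_dualDegrees] at hb
    have pairing_eq_zero := LinearMap.congr_fun ha (Pi.single i ⟨b, hb⟩)
    rw [curlForm_apply, Finset.sum_eq_single i] at pairing_eq_zero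
    · simpa only [Pi.single_eq_same, LinearMap.zero_apply] using pairing_eq_zero
    · intro j _ hj
      rw [Pi.single_eq_of_ne hj, Submodule.coe_zero, mul_zero, map_zero]
    · exact fun hi => absurd (Finset.mem_univ i) hi
  · rw [curlForm_apply, ha]
    simp

set_option maxSynthPendingDepth 3 in
theorem sum_finrank_endPart_add_finrank_closedSystems [Finite (StandardExponent I)]
    (hI : IsMonomialIdeal I) (A : Set (Fin 3 → ℤ)) :
    ∑ j : Fin 3, Module.finrank k (endPart I ((Pi.single j 1 : Fin 3 → ℤ) +ᵥ A)) +
        Module.finrank k (closedSystems I (dualDegrees A)) =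
      ∑ j : Fin 3, Module.finrank k (endPart I ((Pi.single j 1 : Fin 3 → ℤ) +ᵥ dualDegrees A)) +
        Module.finrank k (closedSystems I A) := by
  have := Module.Finite.of_basis (standardBasis hI)
  have ker_flip := ker_curlForm_eq_closedSystems hI (dualDegrees A)
  rw [dualDegrees_dualDegrees, ← curlForm_flip] at ker_flip
  rw [← ker_flip, ← ker_curlForm_eq_closedSystems hI A, ← Module.finrank_pi_fintype,
    ← Module.finrank_pi_fintype]
  exact finrank_add_finrank_ker_flip _

theorem finrank_tangentPart_sub_dualDegrees [Finite (StandardExponent I)] (hI : IsMonomialIdeal I)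
    (A : Set (Fin 3 → ℤ)) :
    (Module.finrank k (tangentPart I A) : ℤ) - Module.finrank k (tangentPart I (dualDegrees A)) =
      Module.finrank k (quotientPart I A) - Module.finrank k (quotientPart I (dualDegrees A)) -
      (Module.finrank k (endPart I A) -
        ∑ j : Fin 3, Module.finrank k (endPart I ((Pi.single j 1 : Fin 3 → ℤ) +ᵥ A)) +
        ∑ j : Fin 3, Module.finrank k (endPart I
          ((Pi.single (j + 1) 1 : Fin 3 → ℤ) +ᵥ (Pi.single (j + 2) 1 : Fin 3 → ℤ) +ᵥ A)) -
        Module.finrank k (endPart I ((1 : Fin 3 → ℤ) +ᵥ A))) := by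
  have count := finrank_tangentPart_add_finrank_endPart hI A
  have dual_count := finrank_tangentPart_add_finrank_endPart hI (dualDegrees A)
  have symmetry := sum_finrank_endPart_add_finrank_closedSystems hI A
  have finrank_dual (j : Fin 3) :
      Module.finrank k (endPart I ((Pi.single j 1 : Fin 3 → ℤ) +ᵥ dualDegrees A)) =
        Module.finrank k (endPart I ((Pi.single (j + 1) 1 : Fin 3 → ℤ) +ᵥ
          (Pi.single (j + 2) 1 : Fin 3 → ℤ) +ᵥ A)) := by
    rw [single_vadd_dualDegrees, finrank_endPart_neg hI]
  simp only [finrank_dual] at symmetry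
  rw [dualDegrees, finrank_endPart_neg hI, ← dualDegrees] at dual_count
  zify at count dual_count symmetry ⊢
  linear_combination count - dual_count - symmetry

theorem prod_indicatorJump (U : Fin 3 → Set ℤ) (δ : Fin 3 → ℤ) :
    ∏ i, indicatorJump (U i) (δ i) =
      (Set.univ.pi U).indicator 1 δ -
      ∑ j : Fin 3, ((Pi.single j 1 : Fin 3 → ℤ) +ᵥ Set.univ.pi U).indicator 1 δ +
      ∑ j : Fin 3, ((Pi.single (j + 1) 1 : Fin 3 → ℤ) +ᵥ (Pi.single (j + 2) 1 : Fin 3 → ℤ) +ᵥ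
        Set.univ.pi U).indicator 1 δ -
      ((1 : Fin 3 → ℤ) +ᵥ Set.univ.pi U).indicator 1 δ := by
  have indicator_univ_pi := indicator_vadd_univ_pi_one 0 U δ
  rw [zero_vadd] at indicator_univ_pi
  simp only [indicator_univ_pi, vadd_vadd, indicator_vadd_univ_pi_one, indicatorJump,
    Fin.prod_univ_three, Fin.sum_univ_three]
  simp only [Fin.isValue, Pi.zero_apply, sub_zero, Pi.single_eq_same, ne_eq, one_ne_zero,
    not_false_eq_true, Pi.single_eq_of_ne, Fin.reduceEq, zero_ne_one, zero_add, Pi.add_apply,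
    add_zero, Fin.reduceAdd, Pi.one_apply]
  ring

theorem finrank_tangentPart_univ_pi_sub [Fintype (StandardExponent I)] (hI : IsMonomialIdeal I)
    (U : Fin 3 → Set ℤ) :
    (Module.finrank k (tangentPart I (Set.univ.pi U)) : ℤ) -
        Module.finrank k (tangentPart I (dualDegrees (Set.univ.pi U))) =
      Module.finrank k (quotientPart I (Set.univ.pi U)) -
        Module.finrank k (quotientPart I (dualDegrees (Set.univ.pi U))) -
      ∑ p : StandardExponent I × StandardExponent I,
        ∏ i, indicatorJump (U i) (exponentDegree p.1.1 i - exponentDegree p.2.1 i) := by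
  have sum_prod := Fintype.sum_congr _ _ fun p : StandardExponent I × StandardExponent I =>
    prod_indicatorJump U (exponentDegree p.1.1 - exponentDegree p.2.1)
  simp only [Pi.sub_apply] at sum_prod
  rw [sum_prod, finrank_tangentPart_sub_dualDegrees hI]
  push_cast
  simp only [finrank_endPart_eq_sum_indicator hI, Finset.sum_sub_distrib, Finset.sum_add_distrib]
  rw [Finset.sum_comm (γ := Fin 3), Finset.sum_comm (γ := Fin 3)]

theorem finrank_tangentSignature_eq_add [Finite (StandardExponent I)] (hI : IsMonomialIdeal I)
    {s t : Fin 3 → SignLetter} (opposite : ∀ i, t i = (s i).opposite) {i j : Fin 3}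
    (hi : s i = .n) (hj : t j = .n) (sign : ∏ i, (s i).sign = -1) :
    Module.finrank k (tangentSignature I s) =
      Module.finrank k (tangentSignature I t) + Module.finrank k (MvPolynomial (Fin 3) k ⧸ I) := by
  cases nonempty_fintype (StandardExponent I)
  have dual : dualDegrees (signatureDegrees s) = signatureDegrees t := by
    rw [dualDegrees_signatureDegrees, _root_.funext opposite]
    rfl
  have quotient_eq_zero {s : Fin 3 → SignLetter} {i : Fin 3} (hi : s i = .n) :
      Module.finrank k (quotientPart I (signatureDegrees s)) = 0 :=
    finrank_quotientPart_eq_zero hI fun δ hδ => by simpa only [hi, SignLetter.Admits] using hδ i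
  have count := finrank_tangentPart_univ_pi_sub hI fun i => {a | (s i).Admits a}
  rw [← signatureDegrees_eq_univ_pi, dual, sum_prod_indicatorJump_admits hI, sign,
    quotient_eq_zero hi, quotient_eq_zero hj] at count
  change Module.finrank k (tangentPart I _) = Module.finrank k (tangentPart I _) + _
  lia

theorem finrank_tangentPart_halfSpace [Finite (StandardExponent I)] (hI : IsMonomialIdeal I) :
    Module.finrank k (tangentPart I {α : Fin 3 → ℤ | 0 ≤ α 0}) =
      Module.finrank k (tangentPart I {α : Fin 3 → ℤ | 0 ≤ α 0}ᶜ) +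
        Module.finrank k (MvPolynomial (Fin 3) k ⧸ I) := by
  cases nonempty_fintype (StandardExponent I)
  have count := finrank_tangentPart_univ_pi_sub hI ![{a | 0 ≤ a}, Set.univ, Set.univ]
  have halfSpace_eq : {α : Fin 3 → ℤ | 0 ≤ α 0} =
      Set.univ.pi ![{a | 0 ≤ a}, Set.univ, Set.univ] := by
    ext α
    simp [Fin.forall_fin_succ]
  have dual_eq : dualDegrees {α : Fin 3 → ℤ | 0 ≤ α 0} = {α : Fin 3 → ℤ | 0 ≤ α 0}ᶜ := by
    ext α
    simp only [mem_dualDegrees, Set.mem_ofPred_eq, Set.mem_compl_iff, Pi.sub_apply, Pi.neg_apply,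
      Pi.one_apply]
    lia
  rw [← halfSpace_eq, dual_eq, finrank_quotientPart_eq_finrank hI, finrank_quotientPart_eq_zero hI
    (i := 0)] at count
  · simp only [CharP.cast_eq_zero, sub_zero, Fin.prod_univ_three, Matrix.cons_val_one,
      Matrix.cons_val_zero, indicatorJump_univ, mul_zero, zero_mul, Finset.sum_const_zero] at count
    lia
  · exact fun α hα => not_le.mp hα
  · exact fun u => Int.natCast_nonneg _

theorem finrank_tangentSpaceAt_modEq [Finite (StandardExponent I)] (hI : IsMonomialIdeal I) :
    Module.finrank k (TangentSpaceAt I) ≡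
      Module.finrank k (MvPolynomial (Fin 3) k ⧸ I) [MOD 2] := by
  have := Module.Finite.of_basis (standardBasis hI)
  have := finite_tangentSpaceAt (I := I)
  have finrank_add := Submodule.finrank_add_eq_of_isCompl
    (isCompl_tangentPart_compl hI {α : Fin 3 → ℤ | 0 ≤ α 0})
  rw [finrank_tangentPart_halfSpace hI] at finrank_add
  rw [Nat.ModEq]
  lia

end ThreeVariables

end MonomialDegrees

theorem mainTheorem1 {k : Type*} [Field k] (d : ℕ) (I : Ideal (MvPolynomial (Fin 3) k))
    (hI : IsMonomialIdeal I)
    (hfin : Module.Finite k (MvPolynomial (Fin 3) k ⧸ I))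
    (hd : Module.finrank k (MvPolynomial (Fin 3) k ⧸ I) = d) :
    Module.Finite k (TangentSpaceAt I) ∧
    Module.finrank k (tangentSignature I ![.p, .p, .n]) =
      Module.finrank k (tangentSignature I ![.n, .n, .p]) + d ∧
    Module.finrank k (tangentSignature I ![.p, .n, .p]) =
      Module.finrank k (tangentSignature I ![.n, .p, .n]) + d ∧
    Module.finrank k (tangentSignature I ![.n, .p, .p]) =
      Module.finrank k (tangentSignature I ![.p, .n, .n]) + d ∧
    Module.finrank k (TangentSpaceAt I) ≡ d [MOD 2] := by
  subst hd
  have := Module.Finite.finite_basis (standardBasis hI)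
  refine ⟨finite_tangentSpaceAt, ?_, ?_, ?_, finrank_tangentSpaceAt_modEq hI⟩
  · exact finrank_tangentSignature_eq_add hI (i := 2) (j := 0)
      (fun i => by fin_cases i <;> rfl) rfl rfl rfl
  · exact finrank_tangentSignature_eq_add hI (i := 1) (j := 0)
      (fun i => by fin_cases i <;> rfl) rfl rfl rfl
  · exact finrank_tangentSignature_eq_add hI (i := 0) (j := 1)
      (fun i => by fin_cases i <;> rfl) rfl rfl rfl
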